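/- Let $S\subset\mathbb{R}^2$ be the unit square centred at the origin, and let $0<\epsilon_1\le\epsilon_2<\infty$. There are constants $C,\theta_1,\theta_2,\theta_3>0$ and $n_0\in\mathbb{N}$, depending only on $\epsilon_1,\epsilon_2$, such that the following holds for every probability density $f$ on $S$ with $\epsilon_1\le\inf_{x\in S}f(x)\le\sup_{x\in S}f(x)\le\epsilon_2$. For each $n\ge 1$ let $X_1,\dots,X_n$ be $n$ independent random nodes in $S$, each distributed with density $f$ (the nodes for different $n$ may be coupled in any way), and let $$TSP_n=\min_{\sigma}\Big(\sum_{i=1}^{n-1}|X_{\sigma(i)}-X_{\sigma(i+1)}|+|X_{\sigma(n)}-X_{\sigma(1)}|\Big),$$ the minimum being over all permutations $\sigma$ of $\{1,\dots,n\}$ and $|\cdot|$ the Euclidean norm, be the length of the shortest cycle through all $n$ nodes. Then $TSP_n$ is square integrable and $$\mathbb{E}\left(TSP_n-\mathbb{E}TSP_n\right)^2\le C n^{2/3}\quad\text{for all } n\ge 1,$$ and in particular $$\frac{1}{\sqrt n}\left(TSP_n-\mathbb{E}TSP_n\right)\longrightarrow 0\ \text{ in probability as } n\to\infty.$$ Moreover,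 for all $n\ge n_0$, $$\theta_1\sqrt n\le\mathbb{E}TSP_n\le 5\sqrt n,\qquad \mathbb{P}\left(TSP_n\le 5\sqrt n\right)=1,$$ $$\mathbb{P}\left(TSP_n\ge\theta_2\sqrt n\right)\ge 1-\exp\left(-\frac{\theta_3 n}{\log n}\right).$$ -/

import Mathlib

open MeasureTheory ProbabilityTheory Filter

noncomputable section

/-- The Euclidean plane. -/
abbrev Plane : Type := EuclideanSpace ℝ (Fin 2)

/-- The closed unit square in the plane, centred at the origin. -/
def unitSquare : Set Plane := {x | ∀ i, x i ∈ Set.Icc (-(1 / 2) : ℝ) (1 / 2)}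

/-- The length of the closed tour `(y₀, y₁, …, y_{t-1}, y₀)`: the sum of the Euclidean distances
between consecutive points, including the distance from the last point back to the first
(`finRotate t` sends `i` to `i + 1` cyclically). -/
def cycleLength {t : ℕ} (y : Fin t → Plane) : ℝ :=
  ∑ i, dist (y i) (y (finRotate t i))

/-- The length of the shortest spanning cycle through the points `x₀, …, x_{n-1}`:
the minimum of the cycle lengths over all orderings of the points. -/
def tspLength {n : ℕ} (x : Fin n → Plane) : ℝ :=
  (Finset.univ : Finset (Equiv.Perm (Fin n))).inf' Finset.univ_nonempty
    fun σ => cycleLength fun i => x (σ i)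

/-- `f` is a probability density on the unit square with `ε₁ ≤ f ≤ ε₂` there. The values of `f`
outside the square play no role. -/
structure IsBoundedDensity (f : Plane → ℝ) (ε₁ ε₂ : ℝ) : Prop where
  aemeasurable : AEMeasurable f (volume.restrict unitSquare)
  lower : ∀ x ∈ unitSquare, ε₁ ≤ f x
  upper : ∀ x ∈ unitSquare, f x ≤ ε₂
  integral_eq_one : ∫ x in unitSquare, f x = 1

/-- The distribution on the unit square with density `f` with respect to Lebesgue measure. -/
def nodeLaw (f : Plane → ℝ) : Measure Plane :=
  (volume.restrict unitSquare).withDensity fun x => ENNReal.ofReal (f x)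

/-- The random points `X₀, …, X_{n-1}` are independent, each distributed in the unit square
with density `f`. -/
structure IsIIDNodes {Ω : Type*} [MeasurableSpace Ω] (P : Measure Ω) (f : Plane → ℝ) {n : ℕ}
    (X : Fin n → Ω → Plane) : Prop where
  hasLaw : ∀ i, HasLaw (X i) (nodeLaw f) P
  indep : iIndepFun X P

/-- The random variable `TSP_n`: the length of the shortest spanning cycle through the `n` random
nodes `X n 0, …, X n (n - 1)` in row `n` of the array `X`. -/
def TSP {Ω : Type*} (X : (n : ℕ) → Fin n → Ω → Plane) (n : ℕ) (ω : Ω) : ℝ :=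
  tspLength fun i => X n i ω

end

/-! The variance is bounded by an absolute constant, 48, which gives the `n ^ (2/3)` bound, and
Chebyshev gives convergence in probability. Deleting one point shortens the optimal tour by an
amount between 0 and twice the distance to that point's nearest neighbour. Balls of half the
nearest-neighbour radii are disjoint, so the squares of these distances have bounded sum
(`sum_sq_tspLength_sub_removeNth_le`). The Efron-Stein inequality
(`integral_sub_integral_sq_le_sum`) turns this into the variance bound.

The upper bound `5√n` is deterministic: among `n` points some pair is at distance `O(1/√n)`, and
deleting points of such pairs one at a time telescopes (`tspLength_le_add_sqrt`).

For the lower tail, a fixed tour is bounded below by an open path, whose Laplace transform at `λ` is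
at most `(c/λ²)^(n-1)`, since the density is bounded above. With `λ` a large multiple of `√n` this
beats the `n!` of the union bound over tours. The failure probability is then at most `exp(-n)`, and
Markov's inequality gives the lower bound on the mean. -/

/-! ### Optimal tours: symmetry, insertion and deletion of a point. -/

theorem cycleLength_nonneg {t : ℕ} (y : Fin t → Plane) : 0 ≤ cycleLength y :=
  Finset.sum_nonneg fun _ _ => dist_nonneg

theorem tspLength_le {n : ℕ} (x : Fin n → Plane) (σ : Equiv.Perm (Fin n)) :
    tspLength x ≤ cycleLength (x ∘ σ) :=
  Finset.inf'_le _ (Finset.mem_univ σ)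

theorem exists_tspLength_eq {n : ℕ} (x : Fin n → Plane) :
    ∃ σ : Equiv.Perm (Fin n), tspLength x = cycleLength (x ∘ σ) := by
  obtain ⟨σ, -, h⟩ := Finset.exists_mem_eq_inf' (Finset.univ_nonempty (α := Equiv.Perm (Fin n)))
    fun σ => cycleLength fun i => x (σ i)
  exact ⟨σ, h⟩

theorem tspLength_nonneg {n : ℕ} (x : Fin n → Plane) : 0 ≤ tspLength x := by
  obtain ⟨σ, h⟩ := exists_tspLength_eq x
  exact h ▸ cycleLength_nonneg _

theorem tspLength_comp_perm_le {n : ℕ} (x : Fin n → Plane) (τ : Equiv.Perm (Fin n)) :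
    tspLength (x ∘ τ) ≤ tspLength x := by
  obtain ⟨σ, h⟩ := exists_tspLength_eq x
  have h1 := tspLength_le (x ∘ τ) (τ⁻¹ * σ)
  have h2 : (x ∘ τ) ∘ (τ⁻¹ * σ : Equiv.Perm (Fin n)) = x ∘ σ := by
    ext1 i
    simp
  rwa [h2, ← h] at h1

theorem tspLength_comp_perm {n : ℕ} (x : Fin n → Plane) (τ : Equiv.Perm (Fin n)) :
    tspLength (x ∘ τ) = tspLength x := by
  refine le_antisymm (tspLength_comp_perm_le x τ) ?_
  have h1 := tspLength_comp_perm_le (x ∘ τ) τ⁻¹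
  have h2 : (x ∘ τ) ∘ (τ⁻¹ : Equiv.Perm (Fin n)) = x := by
    ext1 i
    simp
  rwa [h2] at h1

theorem cycleLength_comp_finRotate_pow {t : ℕ} (y : Fin t → Plane) (k : ℕ) :
    cycleLength (y ∘ (finRotate t ^ k : Equiv.Perm (Fin t))) = cycleLength y := by
  unfold cycleLength
  rw [← Equiv.sum_comp (finRotate t ^ k) fun i => dist (y i) (y (finRotate t i))]
  refine Finset.sum_congr rfl fun i _ => ?_
  simp only [Function.comp_apply]
  rw [← Equiv.Perm.mul_apply, ← Equiv.Perm.mul_apply, ← pow_succ, ← pow_succ']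

theorem exists_finRotate_pow_zero {m : ℕ} (j : Fin (m + 1)) :
    ∃ k : ℕ, (finRotate (m + 1) ^ k : Equiv.Perm (Fin (m + 1))) 0 = j := by
  refine ⟨j, ?_⟩
  have h : ∀ k : ℕ, (finRotate (m + 1) ^ k : Equiv.Perm (Fin (m + 1))) 0 = Fin.ofNat (m + 1) k := by
    intro k
    induction k with
    | zero => simp
    | succ k ih =>
      rw [pow_succ', Equiv.Perm.mul_apply, ih, finRotate_apply]
      ext
      simp [Fin.val_add]
  rw [h]
  simp

/-- An optimal tour can be started at any prescribed point. -/
theorem exists_tspLength_eq_start {m : ℕ} (x : Fin (m + 1) → Plane) (j : Fin (m + 1)) :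
    ∃ σ : Equiv.Perm (Fin (m + 1)), σ 0 = j ∧ tspLength x = cycleLength (x ∘ σ) := by
  obtain ⟨σ, h⟩ := exists_tspLength_eq x
  obtain ⟨k, hk⟩ := exists_finRotate_pow_zero (σ⁻¹ j)
  refine ⟨σ * finRotate (m + 1) ^ k, by simp [hk], ?_⟩
  rw [h, ← cycleLength_comp_finRotate_pow _ k]
  rfl

theorem cycleLength_succ {m : ℕ} (y : Fin (m + 1) → Plane) :
    cycleLength y =
      ∑ k : Fin m, dist (y k.castSucc) (y k.succ) + dist (y (Fin.last m)) (y 0) := by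
  unfold cycleLength
  rw [Fin.sum_univ_castSucc]
  simp

theorem cycleLength_cons {m : ℕ} (p : Plane) (y : Fin (m + 1) → Plane) :
    cycleLength (Fin.cons p y : Fin (m + 2) → Plane) =
      dist p (y 0) + ∑ k : Fin m, dist (y k.castSucc) (y k.succ) + dist (y (Fin.last m)) p := by
  rw [cycleLength_succ, Fin.sum_univ_succ]
  have : ∀ k : Fin m, (Fin.cons p y : Fin (m + 2) → Plane) k.succ.castSucc = y k.castSucc := by
    intro k
    rw [← Fin.succ_castSucc, Fin.cons_succ]
  simp only [this, Fin.cons_succ, Fin.castSucc_zero, Fin.cons_zero, ← Fin.succ_last]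

theorem cons_comp_decomposeFin_symm {m : ℕ} (p : Plane) (y : Fin m → Plane)
    (σ : Equiv.Perm (Fin m)) :
    (Fin.cons p y : Fin (m + 1) → Plane) ∘ Equiv.Perm.decomposeFin.symm (0, σ) =
      Fin.cons p (y ∘ σ) := by
  ext1 i
  refine Fin.cases ?_ (fun i => ?_) i <;> simp

/-- Start the optimal tour at `y j` and insert `p` in the closing edge; by the triangle inequality
the detour costs at most twice the distance from `p` to `y j`. -/
theorem tspLength_cons_le {m : ℕ} (p : Plane) (y : Fin (m + 1) → Plane) (j : Fin (m + 1)) :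
    tspLength (Fin.cons p y : Fin (m + 2) → Plane) ≤ tspLength y + 2 * dist p (y j) := by
  obtain ⟨σ, h0, h⟩ := exists_tspLength_eq_start y j
  have h1 := tspLength_le (Fin.cons p y : Fin (m + 2) → Plane) (Equiv.Perm.decomposeFin.symm (0, σ))
  rw [cons_comp_decomposeFin_symm, cycleLength_cons] at h1
  rw [h, cycleLength_succ]
  simp only [Function.comp_apply, h0] at h1 ⊢
  have := dist_triangle (y (σ (Fin.last m))) (y j) p
  rw [dist_comm (y j) p] at this
  linarith

/-- Shortcut an optimal tour past `p` by the triangle inequality. -/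
theorem le_tspLength_cons {m : ℕ} (p : Plane) (y : Fin (m + 1) → Plane) :
    tspLength y ≤ tspLength (Fin.cons p y : Fin (m + 2) → Plane) := by
  obtain ⟨τ, h0, h⟩ := exists_tspLength_eq_start (Fin.cons p y : Fin (m + 2) → Plane) 0
  obtain ⟨⟨q, σ⟩, rfl⟩ := Equiv.Perm.decomposeFin.symm.surjective τ
  obtain rfl : q = 0 := by simpa using h0
  rw [cons_comp_decomposeFin_symm, cycleLength_cons] at h
  have h1 := tspLength_le y σ
  rw [cycleLength_succ] at h1
  linarith [dist_triangle ((y ∘ σ) (Fin.last m)) p ((y ∘ σ) 0)]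

theorem tspLength_eq_cons_removeNth {m : ℕ} (x : Fin (m + 1) → Plane) (i : Fin (m + 1)) :
    tspLength x = tspLength (Fin.cons (x i) (i.removeNth x) : Fin (m + 1) → Plane) := by
  rw [Fin.cons_removeNth_eq_comp_cycleRange_symm]
  exact (tspLength_comp_perm x _).symm

theorem tspLength_le_removeNth_add {m : ℕ} (x : Fin (m + 2) → Plane) {i j : Fin (m + 2)}
    (hij : j ≠ i) : tspLength x ≤ tspLength (i.removeNth x) + 2 * dist (x i) (x j) := by
  obtain ⟨k, rfl⟩ := Fin.exists_succAbove_eq hij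
  rw [tspLength_eq_cons_removeNth x i]
  exact tspLength_cons_le _ _ k

theorem tspLength_removeNth_le {m : ℕ} (x : Fin (m + 2) → Plane) (i : Fin (m + 2)) :
    tspLength (i.removeNth x) ≤ tspLength x := by
  rw [tspLength_eq_cons_removeNth x i]
  exact le_tspLength_cons _ _

theorem tspLength_one (x : Fin 1 → Plane) : tspLength x = 0 := by
  obtain ⟨σ, h⟩ := exists_tspLength_eq x
  rw [h, cycleLength_succ]
  simp

theorem continuous_tspLength (n : ℕ) : Continuous (tspLength : (Fin n → Plane) → ℝ) := by
  unfold tspLength cycleLength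
  exact Continuous.finset_inf'_apply _ fun σ _ => by fun_prop

/-! ### Packing in the square and deterministic upper bounds. -/

theorem dist_le_two_of_mem_unitSquare {p q : Plane} (hp : p ∈ unitSquare) (hq : q ∈ unitSquare) :
    dist p q ≤ 2 := by
  rw [EuclideanSpace.dist_eq]
  refine Real.sqrt_le_iff.2 ⟨by norm_num, ?_⟩
  have h : ∀ i, dist (p i) (q i) ^ 2 ≤ 1 := fun i => by
    rw [Real.dist_eq, sq_abs]
    obtain ⟨h1, h2⟩ := hp i
    obtain ⟨h3, h4⟩ := hq i
    nlinarith
  rw [Fin.sum_univ_two]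
  linarith [h 0, h 1]

theorem tspLength_le_two_mul {n : ℕ} {x : Fin n → Plane} (hx : ∀ i, x i ∈ unitSquare) :
    tspLength x ≤ 2 * n := by
  refine (tspLength_le x 1).trans ?_
  refine (Finset.sum_le_card_nsmul _ _ 2 fun i _ => ?_).trans_eq (by simp [mul_comm])
  exact dist_le_two_of_mem_unitSquare (hx _) (hx _)

theorem volume_setOf_forall_mem_Icc {a b : ℝ} (hab : a ≤ b) :
    volume {x : Plane | ∀ i, x i ∈ Set.Icc a b} = ENNReal.ofReal ((b - a) ^ 2) := by
  have h := (EuclideanSpace.volume_preserving_symm_measurableEquiv_toLp (Fin 2)).measure_preimage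
    (s := Set.Icc (fun _ => a) fun _ => b) measurableSet_Icc.nullMeasurableSet
  rw [Real.volume_Icc_pi] at h
  rw [ENNReal.ofReal_pow (by linarith)]
  convert h using 2
  · ext x
    simp [Set.mem_Icc, Pi.le_def, forall_and]
  · simp

/-- The balls are disjoint and lie in the concentric square of side `1 + 2ρ`; compare areas. -/
theorem sum_sq_radius_le {n : ℕ} {x : Fin n → Plane} (hx : ∀ i, x i ∈ unitSquare)
    {r : Fin n → ℝ} {ρ : ℝ} (hρ : 0 ≤ ρ) (hr : ∀ i, 0 ≤ r i) (hrρ : ∀ i, r i ≤ ρ)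
    (hd : ∀ i j, i ≠ j → r i + r j ≤ dist (x i) (x j)) :
    ∑ i, Real.pi * r i ^ 2 ≤ (1 + 2 * ρ) ^ 2 := by
  have hdisj : Pairwise (Function.onFun Disjoint fun i => Metric.ball (x i) (r i)) :=
    fun i j hij => Metric.ball_disjoint_ball (hd i j hij)
  have hU := measure_iUnion (μ := (volume : Measure Plane)) hdisj fun i => measurableSet_ball
  have hsub : ⋃ i, Metric.ball (x i) (r i) ⊆
      {y : Plane | ∀ i, y i ∈ Set.Icc (-(1 / 2) - ρ) (1 / 2 + ρ)} := by
    refine Set.iUnion_subset fun i y hy k => ?_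
    have h1 : |y k - x i k| ≤ ρ := by
      have h2 : ‖(y - x i) k‖ ≤ ‖y - x i‖ := PiLp.norm_apply_le _ _
      rw [← dist_eq_norm] at h2
      rw [Metric.mem_ball] at hy
      exact h2.trans (hy.le.trans (hrρ i))
    obtain ⟨h2, h3⟩ := hx i k
    rw [abs_le] at h1
    constructor <;> linarith [h1.1, h1.2]
  have h := measure_mono (μ := (volume : Measure Plane)) hsub
  rw [hU, volume_setOf_forall_mem_Icc (by linarith), tsum_fintype] at h
  have h' : ∀ i, volume (Metric.ball (x i) (r i)) = ENNReal.ofReal (Real.pi * r i ^ 2) := by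
    intro i
    rw [EuclideanSpace.volume_ball_fin_two, mul_comm Real.pi, ENNReal.ofReal_mul (sq_nonneg _),
      ENNReal.ofReal_pow (hr i)]
  simp only [h'] at h
  rw [← ENNReal.ofReal_sum_of_nonneg fun i _ => mul_nonneg Real.pi_pos.le (sq_nonneg _)] at h
  rw [ENNReal.ofReal_le_ofReal_iff (sq_nonneg _)] at h
  convert h using 2
  ring

/-- The square increments of the travelling salesman length on deleting one point sum to at most an
absolute constant. -/
theorem sum_sq_tspLength_sub_removeNth_le {m : ℕ} {x : Fin (m + 2) → Plane}
    (hx : ∀ i, x i ∈ unitSquare) :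
    ∑ i : Fin (m + 2), (tspLength x - tspLength (i.removeNth x)) ^ 2 ≤ 48 := by
  have hex : ∀ i : Fin (m + 2), ∃ j, j ≠ i ∧ ∀ k, k ≠ i → dist (x i) (x j) ≤ dist (x i) (x k) := by
    intro i
    obtain ⟨j, hj, h⟩ := Finset.exists_min_image (Finset.univ.erase i) (fun j => dist (x i) (x j))
      (Finset.card_pos.1 (by simp))
    exact ⟨j, (Finset.mem_erase.1 hj).1, fun k hk => h k (by simp [hk])⟩
  choose g hg hmin using hex
  -- Half nearest-neighbour distances are at most 1, so the enlarged square has side 3.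
  have hpack := sum_sq_radius_le hx (r := fun i => dist (x i) (x (g i)) / 2) zero_le_one
    (fun i => by positivity)
    (fun i => by linarith [dist_le_two_of_mem_unitSquare (hx i) (hx (g i))])
    (fun i j hij => by
      have h1 := hmin i j hij.symm
      have h2 := hmin j i hij
      rw [dist_comm (x j) (x i)] at h2
      linarith)
  have hle : ∀ i, (tspLength x - tspLength (i.removeNth x)) ^ 2 ≤ 4 * dist (x i) (x (g i)) ^ 2 := by
    intro i
    have h1 := tspLength_le_removeNth_add x (hg i)
    have h2 := tspLength_removeNth_le x i
    nlinarith [dist_nonneg (x := x i) (y := x (g i))]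
  have hs : ∑ i, Real.pi * (dist (x i) (x (g i)) / 2) ^ 2 =
      Real.pi / 4 * ∑ i, dist (x i) (x (g i)) ^ 2 := by
    rw [Finset.mul_sum]
    exact Finset.sum_congr rfl fun i _ => by ring
  rw [hs] at hpack
  have h0 : 0 ≤ ∑ i, dist (x i) (x (g i)) ^ 2 := Finset.sum_nonneg fun _ _ => sq_nonneg _
  have h3 := Finset.sum_le_sum fun i (_ : i ∈ Finset.univ) => hle i
  rw [← Finset.mul_sum] at h3
  -- The squared distances sum to at most `36/π < 12`, and `4 * 12 = 48`.
  nlinarith [Real.pi_gt_three]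

theorem exists_dist_le {n : ℕ} (hn : 400 ≤ n) {x : Fin n → Plane} (hx : ∀ i, x i ∈ unitSquare) :
    ∃ i j, j ≠ i ∧ dist (x i) (x j) ≤ 6 / 5 / √n := by
  by_contra! hcon
  have hn' : (400 : ℝ) ≤ n := by exact_mod_cast hn
  have hs : 20 ≤ √(n : ℝ) := Real.le_sqrt_of_sq_le (by linarith)
  have hsq : √(n : ℝ) ^ 2 = n := Real.sq_sqrt (by linarith)
  set s := √(n : ℝ)
  have hr : 3 / 5 / s ≤ 3 / 100 := by
    rw [div_le_iff₀ (by linarith)]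
    linarith
  -- For `n ≥ 400` the radius is at most `3/100`; the total area `9π/25 > 1.13` then exceeds `1.06²
  -- = 1.1236`.
  have h := sum_sq_radius_le hx (r := fun _ => 3 / 5 / s) (ρ := 3 / 100) (by norm_num)
    (fun _ => by positivity) (fun _ => hr) (fun i j hij => by
      have := hcon i j hij.symm
      have h2 : 3 / 5 / s + 3 / 5 / s = 6 / 5 / s := by ring
      linarith)
  rw [Finset.sum_const, Finset.card_univ, Fintype.card_fin, nsmul_eq_mul, ← hsq] at h
  have h2 : s ^ 2 * (Real.pi * (3 / 5 / s) ^ 2) = 9 / 25 * Real.pi := by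
    field_simp
    ring
  rw [h2] at h
  linarith [Real.pi_gt_d2]

theorem tspLength_le_add_sqrt {n : ℕ} {x : Fin n → Plane} (hx : ∀ i, x i ∈ unitSquare) :
    tspLength x ≤ 800 + 24 / 5 * √n := by
  induction n with
  | zero =>
    have := tspLength_le_two_mul hx
    have := Real.sqrt_nonneg ((0 : ℕ) : ℝ)
    push_cast at *
    linarith
  | succ n ih =>
    -- The additive constant 800 is `2 * 400`, covering the range where the packing estimate is not
    -- available.
    by_cases hn : n + 1 ≤ 400
    · have h1 := tspLength_le_two_mul hx
      have h2 : ((n + 1 : ℕ) : ℝ) ≤ 400 := by exact_mod_cast hn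
      have := Real.sqrt_nonneg ((n + 1 : ℕ) : ℝ)
      linarith
    · obtain ⟨m, rfl⟩ : ∃ m, n = m + 1 := ⟨n - 1, by omega⟩
      obtain ⟨i, j, hij, hd⟩ := exists_dist_le (by omega) hx
      have h1 := tspLength_le_removeNth_add x hij
      have h2 := ih (x := i.removeNth x) fun k => hx _
      have ha : √((m + 1 : ℕ) : ℝ) ^ 2 = (m + 1 : ℕ) := Real.sq_sqrt (by positivity)
      have hb : √((m + 1 + 1 : ℕ) : ℝ) ^ 2 = (m + 1 + 1 : ℕ) := Real.sq_sqrt (by positivity)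
      have hb0 : 0 < √((m + 1 + 1 : ℕ) : ℝ) := Real.sqrt_pos.2 (by positivity)
      push_cast at *
      set a := √((m : ℝ) + 1)
      set b := √((m : ℝ) + 1 + 1)
      -- As `b² - a² = 1`, one has `b - a = 1/(a + b) ≥ 1/(2b)`.
      have h3 : 2 * (6 / 5 / b) ≤ 24 / 5 * (b - a) := by
        have : 2 * (6 / 5 / b) = 12 / 5 / b := by ring
        rw [this, div_le_iff₀ hb0]
        nlinarith [sq_nonneg (a - b)]
      linarith

theorem tspLength_le_five_mul_sqrt {n : ℕ} (hn : 16000000 ≤ n) {x : Fin n → Plane}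
    (hx : ∀ i, x i ∈ unitSquare) : tspLength x ≤ 5 * √n := by
  have hn' : (16000000 : ℝ) ≤ n := by exact_mod_cast hn
  -- The threshold makes `800 ≤ √n / 5`.
  have hs : 4000 ≤ √(n : ℝ) := Real.le_sqrt_of_sq_le (by linarith)
  linarith [tspLength_le_add_sqrt hx]

/-! ### Variance inequalities and Efron-Stein. -/

theorem integrable_of_abs_le {α : Type*} [MeasurableSpace α] {μ : Measure α} [IsFiniteMeasure μ]
    {f : α → ℝ} (hf : Measurable f) {B : ℝ} (hB : ∀ x, |f x| ≤ B) : Integrable f μ :=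
  Integrable.of_bound hf.aestronglyMeasurable B (ae_of_all μ fun x => (Real.norm_eq_abs (f x)).trans_le (hB x))

theorem abs_integral_le_of_abs_le {α : Type*} [MeasurableSpace α] {μ : Measure α}
    [IsProbabilityMeasure μ] {f : α → ℝ} {B : ℝ} (hB : ∀ x, |f x| ≤ B) : |∫ x, f x ∂μ| ≤ B := by
  simpa using norm_integral_le_of_norm_le_const (μ := μ) (f := f) (ae_of_all μ hB)

theorem abs_sq_sub_le {a b A B : ℝ} (ha : |a| ≤ A) (hb : |b| ≤ B) :
    |(a - b) ^ 2| ≤ (A + B) ^ 2 := by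
  rw [abs_pow]
  exact pow_le_pow_left₀ (abs_nonneg _) ((abs_sub a b).trans (add_le_add ha hb)) 2

/-- The bias-variance decomposition. -/
theorem integral_sub_const_sq {α : Type*} [MeasurableSpace α] {μ : Measure α}
    [IsProbabilityMeasure μ] {f : α → ℝ} (hf : Measurable f) {B : ℝ} (hB : ∀ x, |f x| ≤ B) (c : ℝ) :
    ∫ x, (f x - c) ^ 2 ∂μ =
      ∫ x, (f x - ∫ y, f y ∂μ) ^ 2 ∂μ + (∫ x, f x ∂μ - c) ^ 2 := by
  set m := ∫ x, f x ∂μ with hm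
  have hi : Integrable f μ := integrable_of_abs_le hf hB
  have hi2 : Integrable (fun x => (f x - m) ^ 2) μ :=
    integrable_of_abs_le ((hf.sub_const m).pow_const 2) fun x => abs_sq_sub_le (hB x) le_rfl
  have h : ∀ x, (f x - c) ^ 2 = (f x - m) ^ 2 + (2 * (m - c) * (f x - m) + (m - c) ^ 2) := by
    intro x
    ring
  simp only [h]
  rw [integral_add hi2 (by fun_prop), integral_add (by fun_prop) (by fun_prop), integral_const_mul,
    integral_sub hi (by fun_prop), ← hm]
  simp

theorem integral_sub_integral_sq_le {α : Type*} [MeasurableSpace α] {μ : Measure α}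
    [IsProbabilityMeasure μ] {f : α → ℝ} (hf : Measurable f) {B : ℝ} (hB : ∀ x, |f x| ≤ B) (c : ℝ) :
    ∫ x, (f x - ∫ y, f y ∂μ) ^ 2 ∂μ ≤ ∫ x, (f x - c) ^ 2 ∂μ := by
  rw [integral_sub_const_sq hf hB c]
  exact le_add_of_nonneg_right (sq_nonneg _)

theorem sq_integral_le_integral_sq {α : Type*} [MeasurableSpace α] {μ : Measure α}
    [IsProbabilityMeasure μ] {f : α → ℝ} (hf : Measurable f) {B : ℝ} (hB : ∀ x, |f x| ≤ B) :
    (∫ x, f x ∂μ) ^ 2 ≤ ∫ x, f x ^ 2 ∂μ := by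
  have h := integral_sub_const_sq (μ := μ) hf hB 0
  simp only [sub_zero] at h
  rw [h]
  exact le_add_of_nonneg_left (integral_nonneg fun _ => sq_nonneg _)

section Pi

variable {E : Type*} [MeasurableSpace E]

theorem measurable_finCons {n : ℕ} :
    Measurable fun p : E × (Fin n → E) => (Fin.cons p.1 p.2 : Fin (n + 1) → E) := by
  convert (MeasurableEquiv.piFinSuccAbove (fun _ : Fin (n + 1) => E) 0).symm.measurable using 1
  funext p
  simp [MeasurableEquiv.piFinSuccAbove, Fin.insertNthEquiv]

theorem measurePreserving_finCons (μ : Measure E) [IsProbabilityMeasure μ] (n : ℕ) :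
    MeasurePreserving (fun p : E × (Fin n → E) => (Fin.cons p.1 p.2 : Fin (n + 1) → E))
      (μ.prod (Measure.pi fun _ => μ)) (Measure.pi fun _ => μ) := by
  convert (measurePreserving_piFinSuccAbove (fun _ : Fin (n + 1) => μ) 0).symm using 1
  funext p
  simp [MeasurableEquiv.piFinSuccAbove, Fin.insertNthEquiv]

theorem integral_pi_succ {μ : Measure E} [IsProbabilityMeasure μ] {n : ℕ}
    {f : (Fin (n + 1) → E) → ℝ} (hf : Measurable f) {B : ℝ} (hB : ∀ x, |f x| ≤ B) :
    ∫ x, f x ∂(Measure.pi fun _ => μ) =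
      ∫ y, ∫ a, f (Fin.cons a y) ∂μ ∂(Measure.pi fun _ : Fin n => μ) := by
  have h := measurePreserving_finCons μ n
  rw [← h.map_eq, integral_map h.measurable.aemeasurable hf.aestronglyMeasurable]
  exact integral_prod_symm _
    (integrable_of_abs_le (hf.comp measurable_finCons) fun x => hB _)

theorem measurable_integral_finCons {μ : Measure E} [IsProbabilityMeasure μ] {n : ℕ}
    {f : (Fin (n + 1) → E) → ℝ} (hf : Measurable f) :
    Measurable fun y : Fin n → E => ∫ a, f (Fin.cons a y) ∂μ :=
  ((hf.comp measurable_finCons).stronglyMeasurable.integral_prod_left').measurable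

/-- The Efron-Stein inequality: `G i` is any approximation of `F` that ignores the coordinate
`i`. -/
theorem integral_sub_integral_sq_le_sum (μ : Measure E) [IsProbabilityMeasure μ] {B : ℝ} (n : ℕ) :
    ∀ (F : (Fin n → E) → ℝ) (G : Fin n → (Fin n → E) → ℝ), Measurable F → (∀ i, Measurable (G i)) →
      (∀ x, |F x| ≤ B) → (∀ i x, |G i x| ≤ B) →
      (∀ i x a, G i (Function.update x i a) = G i x) →
      ∫ x, (F x - ∫ y, F y ∂(Measure.pi fun _ => μ)) ^ 2 ∂(Measure.pi fun _ => μ) ≤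
        ∑ i, ∫ x, (F x - G i x) ^ 2 ∂(Measure.pi fun _ => μ) := by
  induction n with
  | zero =>
    intro F G _ _ _ _ _
    have h : ∀ x, F x = F Fin.elim0 := fun x => congrArg F (Subsingleton.elim _ _)
    simp [h]
  | succ n ih =>
    intro F G hF hG hFB hGB hGu
    set m := ∫ y, F y ∂(Measure.pi fun _ => μ) with hm
    have hmB : |m| ≤ B := abs_integral_le_of_abs_le hFB
    have hcons : ∀ y : Fin n → E, Measurable fun a : E => (Fin.cons a y : Fin (n + 1) → E) :=
      fun y => measurable_finCons.comp measurable_prodMk_right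
    -- Averaging out the first coordinate splits the variance of `F` into the mean conditional
    -- variance plus the variance of `H`.
    set H : (Fin n → E) → ℝ := fun y => ∫ a, F (Fin.cons a y) ∂μ
    have hHm : ∫ y, H y ∂(Measure.pi fun _ => μ) = m := (integral_pi_succ hF hFB).symm
    have hHmeas : Measurable H := measurable_integral_finCons hF
    have hHB : ∀ y, |H y| ≤ B := fun y => abs_integral_le_of_abs_le fun a => hFB _
    have hsq : ∀ i, Measurable fun x => (F x - G i x) ^ 2 := fun i => (hF.sub (hG i)).pow_const 2
    have hsqB : ∀ i x, |(F x - G i x) ^ 2| ≤ (B + B) ^ 2 :=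
      fun i x => abs_sq_sub_le (hFB x) (hGB i x)
    have hint : ∀ i, Integrable (fun y => ∫ a, (F (Fin.cons a y) - G i (Fin.cons a y)) ^ 2 ∂μ)
        (Measure.pi fun _ : Fin n => μ) := fun i =>
      integrable_of_abs_le (measurable_integral_finCons (hsq i))
        fun y => abs_integral_le_of_abs_le fun a => hsqB i _
    have hHint : Integrable (fun y => (H y - m) ^ 2) (Measure.pi fun _ : Fin n => μ) :=
      integrable_of_abs_le ((hHmeas.sub_const m).pow_const 2)
        fun y => abs_sq_sub_le (hHB y) hmB
    have hfirst : ∫ x, (F x - m) ^ 2 ∂(Measure.pi fun _ => μ) ≤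
        ∫ x, (F x - G 0 x) ^ 2 ∂(Measure.pi fun _ => μ) +
          ∫ y, (H y - m) ^ 2 ∂(Measure.pi fun _ : Fin n => μ) := by
      rw [integral_pi_succ (hsq 0) (hsqB 0), ← integral_add (hint 0) hHint,
        integral_pi_succ ((hF.sub_const m).pow_const 2)
          fun x => abs_sq_sub_le (hFB x) hmB]
      refine integral_mono ?_ ((hint 0).add hHint) fun y => ?_
      · exact integrable_of_abs_le (measurable_integral_finCons ((hF.sub_const m).pow_const 2))
          fun y => abs_integral_le_of_abs_le fun a => abs_sq_sub_le (hFB _) hmB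
      · have hFy : Measurable fun a => F (Fin.cons a y) := hF.comp (hcons y)
        -- With the other coordinates fixed, `G 0` is constant, and the conditional mean is the best
        -- constant approximation.
        obtain ⟨c, hc⟩ : ∃ c, ∀ a, G 0 (Fin.cons a y) = c := by
          rcases isEmpty_or_nonempty E with hE | ⟨⟨b⟩⟩
          · exact ⟨0, fun a => hE.elim a⟩
          · exact ⟨G 0 (Fin.cons b y), fun a => by
              rw [← hGu 0 (Fin.cons b y) a, Fin.update_cons_zero]⟩
        simp only [hc]
        rw [integral_sub_const_sq hFy (fun a => hFB _) m]
        exact add_le_add_left (integral_sub_integral_sq_le hFy (fun a => hFB _) c) _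
    -- Averages of the `G i.succ` over the first coordinate are admissible approximations of `H`;
    -- Jensen then bounds their errors by the original ones.
    have hsecond := ih H (fun i y => ∫ a, G i.succ (Fin.cons a y) ∂μ) hHmeas
      (fun i => measurable_integral_finCons (hG _)) hHB
      (fun i y => abs_integral_le_of_abs_le fun a => hGB _ _)
      (fun i y b => by simp only [Fin.cons_update, hGu])
    rw [hHm] at hsecond
    rw [Fin.sum_univ_succ]
    refine hfirst.trans (add_le_add_right (hsecond.trans (Finset.sum_le_sum fun i _ => ?_)) _)
    rw [integral_pi_succ (hsq i.succ) (hsqB i.succ)]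
    refine integral_mono ?_ (hint i.succ) fun y => ?_
    · refine integrable_of_abs_le
        ((hHmeas.sub (measurable_integral_finCons (hG i.succ))).pow_const 2) fun y =>
        abs_sq_sub_le (hHB y) (abs_integral_le_of_abs_le fun a => hGB i.succ _)
    · have hFy : Measurable fun a => F (Fin.cons a y) := hF.comp (hcons y)
      have hGy : Measurable fun a => G i.succ (Fin.cons a y) := (hG i.succ).comp (hcons y)
      have := sq_integral_le_integral_sq (μ := μ) (hFy.sub hGy) (B := B + B)
        fun a => (abs_sub _ _).trans (add_le_add (hFB _) (hGB _ _))
      simp only [Pi.sub_apply] at this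
      rw [integral_sub (integrable_of_abs_le hFy fun a => hFB _)
        (integrable_of_abs_le hGy fun a => hGB _ _)] at this
      exact this

end Pi

/-! ### The node law and independent nodes. -/

theorem measurableSet_unitSquare : MeasurableSet unitSquare := by
  have h : unitSquare = ⋂ i : Fin 2, (fun x : Plane => x i) ⁻¹' Set.Icc (-(1 / 2) : ℝ) (1 / 2) := by
    ext x
    simp [unitSquare]
  rw [h]
  exact MeasurableSet.iInter fun i => measurableSet_Icc.preimage (by fun_prop)

theorem ae_mem_unitSquare (f : Plane → ℝ) : ∀ᵐ x ∂nodeLaw f, x ∈ unitSquare :=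
  (withDensity_absolutelyContinuous _ _).ae_le (ae_restrict_mem measurableSet_unitSquare)

theorem nodeLaw_le_smul_volume {f : Plane → ℝ} {ε₁ ε₂ : ℝ} (hf : IsBoundedDensity f ε₁ ε₂) :
    nodeLaw f ≤ ENNReal.ofReal ε₂ • volume := by
  have h1 : nodeLaw f ≤ (volume.restrict unitSquare).withDensity fun _ => ENNReal.ofReal ε₂ := by
    refine withDensity_mono ?_
    filter_upwards [ae_restrict_mem measurableSet_unitSquare] with x hx
    exact ENNReal.ofReal_le_ofReal (hf.upper x hx)
  rw [withDensity_const] at h1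
  refine h1.trans ?_
  gcongr
  exact Measure.restrict_le_self

section IID

variable {Ω : Type*} [MeasurableSpace Ω] {P : Measure Ω} {f : Plane → ℝ} {n : ℕ}
  {X : Fin n → Ω → Plane}

theorem IsIIDNodes.aemeasurable (hX : IsIIDNodes P f X) : AEMeasurable (fun ω i => X i ω) P :=
  aemeasurable_pi_lambda _ fun i => (hX.hasLaw i).aemeasurable

theorem IsIIDNodes.map_eq_pi [IsProbabilityMeasure P] (hX : IsIIDNodes P f X) :
    P.map (fun ω i => X i ω) = Measure.pi fun _ => nodeLaw f := by
  rw [(iIndepFun_iff_map_fun_eq_pi_map fun i => (hX.hasLaw i).aemeasurable).1 hX.indep]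
  simp only [fun i => (hX.hasLaw i).map_eq]

theorem IsIIDNodes.comp_perm (hX : IsIIDNodes P f X) (σ : Equiv.Perm (Fin n)) :
    IsIIDNodes P f fun i => X (σ i) where
  hasLaw i := hX.hasLaw (σ i)
  indep := hX.indep.precomp σ.injective

theorem IsIIDNodes.ae_mem_unitSquare (hX : IsIIDNodes P f X) :
    ∀ᵐ ω ∂P, ∀ i, X i ω ∈ unitSquare := by
  refine ae_all_iff.2 fun i => ?_
  have h := _root_.ae_mem_unitSquare f
  rw [← (hX.hasLaw i).map_eq] at h
  exact ae_of_ae_map (hX.hasLaw i).aemeasurable h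

end IID

/-! ### Exponential moments and the lower tail. -/

theorem integrable_exp_neg_norm : Integrable fun x : Plane => Real.exp (-‖x‖) := by
  have h : Integrable fun x : Plane => 6 * Real.exp 1 * (1 + ‖x‖) ^ (-(3 : ℝ)) :=
    (integrable_one_add_norm (by simp; norm_num)).const_mul _
  refine h.mono' (by fun_prop) (ae_of_all _ fun x => ?_)
  have h0 : 0 < 1 + ‖x‖ := by positivity
  -- `exp(1 + t) ≥ (1 + t)³ / 3!` gives cubic decay, integrable in dimension 2.
  have h1 := Real.pow_div_factorial_le_exp (x := 1 + ‖x‖) h0.le 3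
  rw [Real.norm_of_nonneg (Real.exp_pos _).le, Real.rpow_neg h0.le, ← div_eq_mul_inv,
    le_div_iff₀ (by positivity)]
  rw [Real.exp_add, Nat.factorial, Nat.factorial, Nat.factorial, div_le_iff₀ (by positivity)] at h1
  have h2 : Real.exp (-‖x‖) * Real.exp ‖x‖ = 1 := by
    rw [← Real.exp_add]
    simp
  have h3 : (1 + ‖x‖) ^ (3 : ℝ) = (1 + ‖x‖) ^ 3 := by exact_mod_cast Real.rpow_natCast _ 3
  rw [h3]
  have h4 := mul_le_mul_of_nonneg_left h1 (Real.exp_pos (-‖x‖)).le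
  refine h4.trans_eq ?_
  push_cast [Nat.factorial]
  linear_combination 6 * Real.exp 1 * h2

theorem lintegral_exp_neg_mul_dist {lam : ℝ} (hlam : 0 < lam) (b : Plane) :
    ∫⁻ a : Plane, ENNReal.ofReal (Real.exp (-lam * dist a b)) =
      ENNReal.ofReal ((∫ x : Plane, Real.exp (-‖x‖)) / lam ^ 2) := by
  simp only [dist_eq_norm]
  rw [lintegral_sub_right_eq_self (fun a : Plane => ENNReal.ofReal (Real.exp (-lam * ‖a‖))) b]
  have h : ∀ a : Plane, Real.exp (-lam * ‖a‖) = Real.exp (-‖lam • a‖) := fun a => by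
    rw [norm_smul, Real.norm_of_nonneg hlam.le, neg_mul]
  simp only [h]
  rw [← ofReal_integral_eq_lintegral_ofReal (integrable_exp_neg_norm.comp_smul hlam.ne')
    (ae_of_all _ fun _ => (Real.exp_pos _).le),
    Measure.integral_comp_smul volume (fun x : Plane => Real.exp (-‖x‖))]
  congr 1
  rw [finrank_euclideanSpace_fin, abs_of_nonneg (by positivity), smul_eq_mul]
  ring

/-- The first point of an open path occurs in a single factor; integrate it out, at cost `K`, and
repeat. -/
theorem lintegral_prod_succ_le {E : Type*} [MeasurableSpace E] (μ : Measure E)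
    [IsProbabilityMeasure μ] {g : E → E → ENNReal} (hg : Measurable fun p : E × E => g p.1 p.2)
    {K : ENNReal} (hK : ∀ b, ∫⁻ a, g a b ∂μ ≤ K) (m : ℕ) :
    ∫⁻ y : Fin (m + 1) → E, ∏ k : Fin m, g (y k.castSucc) (y k.succ) ∂(Measure.pi fun _ => μ) ≤
      K ^ m := by
  have hmeas : ∀ m : ℕ, Measurable fun y : Fin (m + 1) → E =>
      ∏ k : Fin m, g (y k.castSucc) (y k.succ) := fun m =>
    Finset.measurable_prod _ fun k _ =>
      hg.comp (f := fun y : Fin (m + 1) → E => (y k.castSucc, y k.succ))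
        ((measurable_pi_apply k.castSucc).prodMk (measurable_pi_apply k.succ))
  induction m with
  | zero => simp
  | succ m ih =>
    have h := measurePreserving_finCons μ (m + 1)
    rw [← h.map_eq, lintegral_map (hmeas (m + 1)) h.measurable,
      lintegral_prod_symm]
    swap
    · exact ((hmeas (m + 1)).comp h.measurable).aemeasurable
    rw [pow_succ']
    refine le_trans ?_ (mul_le_mul_right ih K)
    rw [← lintegral_const_mul _ (hmeas m)]
    refine lintegral_mono fun z => ?_
    have hsplit : ∀ a, ∏ k : Fin (m + 1), g ((Fin.cons a z : Fin (m + 2) → E) k.castSucc)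
        ((Fin.cons a z : Fin (m + 2) → E) k.succ) =
        g a (z 0) * ∏ k : Fin m, g (z k.castSucc) (z k.succ) := by
      intro a
      rw [Fin.prod_univ_succ]
      simp only [Fin.castSucc_zero, Fin.cons_zero, Fin.cons_succ, ← Fin.succ_castSucc]
    simp only [hsplit]
    rw [lintegral_mul_const]
    swap
    · exact hg.comp measurable_prodMk_right
    exact mul_le_mul_left (hK _) _

section Tail

variable {Ω : Type*} [MeasurableSpace Ω] {P : Measure Ω} [IsProbabilityMeasure P] {f : Plane → ℝ}
  {ε₁ ε₂ : ℝ}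

theorem IsIIDNodes.isProbabilityMeasure_nodeLaw {m : ℕ} {X : Fin (m + 1) → Ω → Plane}
    (hX : IsIIDNodes P f X) : IsProbabilityMeasure (nodeLaw f) :=
  (hX.hasLaw 0).isProbabilityMeasure_iff.1 inferInstance

theorem lintegral_exp_neg_path_le (hf : IsBoundedDensity f ε₁ ε₂) {lam : ℝ}
    (hlam : 0 < lam) {m : ℕ} {X : Fin (m + 1) → Ω → Plane} (hX : IsIIDNodes P f X) :
    ∫⁻ ω, ∏ k : Fin m, ENNReal.ofReal (Real.exp (-lam * dist (X k.castSucc ω) (X k.succ ω))) ∂P ≤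
      (ENNReal.ofReal ε₂ * ENNReal.ofReal ((∫ x : Plane, Real.exp (-‖x‖)) / lam ^ 2)) ^ m := by
  have := hX.isProbabilityMeasure_nodeLaw
  refine le_trans (le_of_eq ?_) (lintegral_prod_succ_le (nodeLaw f)
    (g := fun a b => ENNReal.ofReal (Real.exp (-lam * dist a b))) (by fun_prop) (fun b => ?_) m)
  · rw [← hX.map_eq_pi, lintegral_map' (by fun_prop) hX.aemeasurable]
  · refine (lintegral_mono' (nodeLaw_le_smul_volume hf) le_rfl).trans_eq ?_
    rw [lintegral_smul_measure, lintegral_exp_neg_mul_dist hlam, smul_eq_mul]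

/-- The summand of an optimal tour alone is at least 1: dropping the closing edge only shortens it.
-/
theorem one_le_sum_exp_mul_prod_exp {lam L : ℝ} (hlam : 0 < lam) {m : ℕ}
    {x : Fin (m + 1) → Plane} (hx : tspLength x < L) :
    1 ≤ ∑ σ : Equiv.Perm (Fin (m + 1)), ENNReal.ofReal (Real.exp (lam * L)) *
      ∏ k : Fin m, ENNReal.ofReal (Real.exp (-lam * dist (x (σ k.castSucc)) (x (σ k.succ)))) := by
  obtain ⟨σ, hσ⟩ := exists_tspLength_eq x
  rw [hσ, cycleLength_succ] at hx
  refine le_trans ?_ (Finset.single_le_sum (f := fun σ : Equiv.Perm (Fin (m + 1)) =>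
    ENNReal.ofReal (Real.exp (lam * L)) *
      ∏ k : Fin m, ENNReal.ofReal (Real.exp (-lam * dist (x (σ k.castSucc)) (x (σ k.succ)))))
    (fun _ _ => zero_le) (Finset.mem_univ σ))
  rw [← ENNReal.ofReal_prod_of_nonneg fun _ _ => (Real.exp_pos _).le,
    ← ENNReal.ofReal_mul (Real.exp_pos _).le, ← Real.exp_sum, ← Real.exp_add,
    ENNReal.one_le_ofReal, ← Finset.mul_sum]
  refine Real.one_le_exp ?_
  have := dist_nonneg (x := (x ∘ σ) (Fin.last m)) (y := (x ∘ σ) 0)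
  simp only [Function.comp_apply] at hx this
  nlinarith

/-- The Chernoff bound for the length of each fixed tour, summed over all tours. -/
theorem measure_tspLength_lt_le (hf : IsBoundedDensity f ε₁ ε₂) {lam : ℝ}
    (hlam : 0 < lam) (L : ℝ) {m : ℕ} {X : Fin (m + 1) → Ω → Plane} (hX : IsIIDNodes P f X) :
    P {ω | tspLength (fun i => X i ω) < L} ≤
      (m + 1).factorial * (ENNReal.ofReal (Real.exp (lam * L)) *
        (ENNReal.ofReal ε₂ * ENNReal.ofReal ((∫ x : Plane, Real.exp (-‖x‖)) / lam ^ 2)) ^ m) := by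
  have hmeas : ∀ σ : Equiv.Perm (Fin (m + 1)), AEMeasurable (fun ω => ∏ k : Fin m,
      ENNReal.ofReal (Real.exp (-lam * dist (X (σ k.castSucc) ω) (X (σ k.succ) ω)))) P := by
    intro σ
    refine Finset.aemeasurable_fun_prod _ fun k _ => ?_
    have h1 := (hX.hasLaw (σ k.castSucc)).aemeasurable
    have h2 := (hX.hasLaw (σ k.succ)).aemeasurable
    fun_prop
  have hcheb : P {ω | tspLength (fun i => X i ω) < L} ≤
      ∫⁻ ω, ∑ σ : Equiv.Perm (Fin (m + 1)), ENNReal.ofReal (Real.exp (lam * L)) *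
        ∏ k : Fin m,
          ENNReal.ofReal (Real.exp (-lam * dist (X (σ k.castSucc) ω) (X (σ k.succ) ω))) ∂P :=
    meas_le_lintegral₀ (Finset.aemeasurable_fun_sum _ fun σ _ => (hmeas σ).const_mul _)
      fun ω hω => one_le_sum_exp_mul_prod_exp hlam (x := fun i => X i ω) hω
  rw [lintegral_finsetSum' _ fun σ _ => (hmeas σ).const_mul _] at hcheb
  refine hcheb.trans ((Finset.sum_le_card_nsmul _ _ (ENNReal.ofReal (Real.exp (lam * L)) *
    (ENNReal.ofReal ε₂ * ENNReal.ofReal ((∫ x : Plane, Real.exp (-‖x‖)) / lam ^ 2)) ^ m)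
      fun σ _ => ?_).trans_eq ?_)
  · have h := lintegral_exp_neg_path_le hf hlam (hX.comp_perm σ)
    rw [lintegral_const_mul'' _ (hmeas σ)]
    exact mul_le_mul_right h _
  · rw [Finset.card_univ, Fintype.card_perm, Fintype.card_fin, nsmul_eq_mul]

theorem measureReal_tspLength_lt_le (hε₂ : 0 ≤ ε₂) (hf : IsBoundedDensity f ε₁ ε₂) {lam : ℝ}
    (hlam : 0 < lam) (L : ℝ) {m : ℕ} {X : Fin (m + 1) → Ω → Plane} (hX : IsIIDNodes P f X) :
    P.real {ω | tspLength (fun i => X i ω) < L} ≤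
      (m + 1).factorial * (Real.exp (lam * L) *
        (ε₂ * ((∫ x : Plane, Real.exp (-‖x‖)) / lam ^ 2)) ^ m) := by
  have hI : 0 ≤ ∫ x : Plane, Real.exp (-‖x‖) := integral_nonneg fun _ => (Real.exp_pos _).le
  refine ENNReal.toReal_le_of_le_ofReal (by positivity)
    ((measure_tspLength_lt_le hf hlam L hX).trans_eq ?_)
  rw [ENNReal.ofReal_mul (by positivity), ENNReal.ofReal_mul (by positivity),
    ENNReal.ofReal_pow (by positivity), ENNReal.ofReal_mul hε₂, ENNReal.ofReal_natCast]

theorem measureReal_tspLength_lt_le_exp_neg (hε₂ : 0 ≤ ε₂) (hf : IsBoundedDensity f ε₁ ε₂) {a : ℝ}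
    (ha : 1 ≤ a) (haI : ε₂ * (∫ x : Plane, Real.exp (-‖x‖)) ≤ a * Real.exp (-4)) {n : ℕ}
    (hn : 4 ≤ n) {X : Fin n → Ω → Plane} (hX : IsIIDNodes P f X) :
    P.real {ω | tspLength (fun i => X i ω) < 1 / a * √n} ≤ Real.exp (-n) := by
  obtain ⟨m, rfl⟩ : ∃ m, n = m + 1 := ⟨n - 1, by omega⟩
  set N : ℝ := ((m + 1 : ℕ) : ℝ) with hN
  have hN4 : 4 ≤ N := by
    rw [hN]
    exact_mod_cast hn
  have hs : 0 < √N := Real.sqrt_pos.2 (by linarith)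
  have hsq : √N ^ 2 = N := Real.sq_sqrt (by linarith)
  -- This choice of `lam` makes `lam * L = n` and each edge factor at most `exp(-4) / n`; the powers
  -- of `n` then cancel those in `n! ≤ n ^ n`, up to one factor `n`.
  have h := measureReal_tspLength_lt_le hε₂ hf (lam := a * √N) (by positivity) (1 / a * √N) hX
  refine h.trans ?_
  set I := ∫ x : Plane, Real.exp (-‖x‖)
  have hI : 0 ≤ I := integral_nonneg fun _ => (Real.exp_pos _).le
  have h1 : a * √N * (1 / a * √N) = N := by
    field_simp
    exact hsq
  have h2 : ε₂ * (I / (a * √N) ^ 2) ≤ Real.exp (-4) / N := by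
    rw [mul_pow, hsq, ← mul_div_assoc, div_le_div_iff₀ (by positivity) (by positivity)]
    have h3 : a * Real.exp (-4) ≤ a ^ 2 * Real.exp (-4) :=
      mul_le_mul_of_nonneg_right (by nlinarith) (Real.exp_pos _).le
    nlinarith [mul_le_mul_of_nonneg_right (haI.trans h3) (by linarith : 0 ≤ N)]
  have h3 : ((m + 1).factorial : ℝ) ≤ N * N ^ m := by
    rw [← pow_succ', hN]
    exact_mod_cast Nat.factorial_le_pow (m + 1)
  have h4 : (ε₂ * (I / (a * √N) ^ 2)) ^ m ≤ Real.exp (-4 * m) / N ^ m := by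
    refine (pow_le_pow_left₀ (by positivity) h2 m).trans_eq ?_
    rw [div_pow, ← Real.exp_nat_mul, mul_comm (m : ℝ)]
  rw [h1]
  calc ((m + 1).factorial : ℝ) * (Real.exp N * (ε₂ * (I / (a * √N) ^ 2)) ^ m)
      ≤ N * N ^ m * (Real.exp N * (Real.exp (-4 * m) / N ^ m)) := by gcongr
    _ = N * Real.exp (N + -4 * m) := by
      rw [Real.exp_add]
      field_simp
    -- The spare factor `N` is absorbed by `exp N`; the exponent becomes `2N - 4m = 4 - 2N`, at most
    -- `-N` since `N ≥ 4`.
    _ ≤ Real.exp N * Real.exp (N + -4 * m) := by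
      gcongr
      linarith [Real.add_one_le_exp N]
    _ ≤ Real.exp (-N) := by
      rw [← Real.exp_add]
      refine Real.exp_le_exp.2 ?_
      have : N = m + 1 := by simp [hN]
      linarith

end Tail

/-! ### The variance bound for random nodes. -/

noncomputable section

/-- The coordinatewise retraction of the plane onto the unit square. -/
def clampSquare (x : Plane) : Plane :=
  WithLp.toLp 2 fun i => max (-(1 / 2)) (min (1 / 2) (x i))

end

theorem clampSquare_mem (x : Plane) : clampSquare x ∈ unitSquare := fun i =>
  ⟨le_max_left _ _, max_le (by norm_num) (min_le_left _ _)⟩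

theorem clampSquare_of_mem {x : Plane} (hx : x ∈ unitSquare) : clampSquare x = x := by
  ext i
  obtain ⟨h1, h2⟩ := hx i
  change max (-(1 / 2)) (min (1 / 2) (x i)) = x i
  rw [min_eq_right h2, max_eq_right h1]

theorem continuous_clampSquare : Continuous clampSquare := by
  unfold clampSquare
  fun_prop

section IID

variable {Ω : Type*} [MeasurableSpace Ω] {P : Measure Ω} [IsProbabilityMeasure P] {f : Plane → ℝ}

theorem IsIIDNodes.memLp_tspLength {n : ℕ} {X : Fin n → Ω → Plane} (hX : IsIIDNodes P f X) :
    MemLp (fun ω => tspLength fun i => X i ω) 2 P := by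
  refine MemLp.of_bound ?_ (2 * n) ?_
  · exact ((continuous_tspLength n).measurable.comp_aemeasurable
      hX.aemeasurable).aestronglyMeasurable
  · filter_upwards [hX.ae_mem_unitSquare] with ω hω
    rw [Real.norm_of_nonneg (tspLength_nonneg _)]
    exact tspLength_le_two_mul hω

theorem IsIIDNodes.integral_tspLength_sub_sq_le_of_two_le {m : ℕ} {X : Fin (m + 2) → Ω → Plane}
    (hX : IsIIDNodes P f X) :
    ∫ ω, (tspLength (fun i => X i ω) - ∫ ω', tspLength (fun i => X i ω') ∂P) ^ 2 ∂P ≤ 48 := by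
  have := hX.isProbabilityMeasure_nodeLaw
  have hcont : Continuous fun x : Fin (m + 2) → Plane => clampSquare ∘ x :=
    continuous_pi fun i => continuous_clampSquare.comp (continuous_apply i)
  -- The nodes lie in the square only almost surely, whereas Efron-Stein is stated with bounds at
  -- every point. Clamping supplies these without changing the tour length almost surely.
  set F : (Fin (m + 2) → Plane) → ℝ := fun x => tspLength (clampSquare ∘ x) with hF
  set G : Fin (m + 2) → (Fin (m + 2) → Plane) → ℝ := fun i x =>
    tspLength (i.removeNth (clampSquare ∘ x)) with hG
  have hFm : Measurable F := ((continuous_tspLength _).comp hcont).measurable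
  have hGm : ∀ i, Measurable (G i) := fun i =>
    ((continuous_tspLength _).comp
      (continuous_pi fun k => (continuous_apply (i.succAbove k)).comp hcont)).measurable
  have hFB : ∀ x, |F x| ≤ 2 * (m + 2 : ℕ) := fun x => by
    rw [abs_of_nonneg (tspLength_nonneg _)]
    exact tspLength_le_two_mul fun i => clampSquare_mem _
  have hGF : ∀ i x, G i x ≤ F x := fun i x => tspLength_removeNth_le _ i
  have hGB : ∀ i x, |G i x| ≤ 2 * (m + 2 : ℕ) := fun i x => by
    rw [abs_of_nonneg (tspLength_nonneg _)]
    exact (hGF i x).trans ((le_abs_self _).trans (hFB x))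
  have hGu : ∀ i x a, G i (Function.update x i a) = G i x := fun i x a => by
    simp only [hG, Function.comp_update, Fin.removeNth_update]
  have hES := integral_sub_integral_sq_le_sum (nodeLaw f) (m + 2) F G hFm hGm hFB hGB hGu
  have hsum : ∑ i, ∫ x, (F x - G i x) ^ 2 ∂(Measure.pi fun _ => nodeLaw f) ≤ 48 := by
    rw [← integral_finsetSum]
    swap
    · exact fun i _ => integrable_of_abs_le ((hFm.sub (hGm i)).pow_const 2)
        fun x => abs_sq_sub_le (hFB x) (hGB i x)
    refine (le_abs_self _).trans (abs_integral_le_of_abs_le fun x => ?_)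
    rw [abs_of_nonneg (Finset.sum_nonneg fun _ _ => sq_nonneg _)]
    exact sum_sq_tspLength_sub_removeNth_le fun i => clampSquare_mem _
  have hae : ∀ᵐ ω ∂P, tspLength (fun i => X i ω) = F fun i => X i ω := by
    filter_upwards [hX.ae_mem_unitSquare] with ω hω
    exact congrArg tspLength (funext fun i => (clampSquare_of_mem (hω i)).symm)
  have hmean : ∫ ω, tspLength (fun i => X i ω) ∂P =
      ∫ x, F x ∂(Measure.pi fun _ => nodeLaw f) := by
    rw [integral_congr_ae hae, ← hX.map_eq_pi,
      integral_map hX.aemeasurable hFm.aestronglyMeasurable]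
  refine le_trans (le_of_eq ?_) (hES.trans hsum)
  rw [hmean]
  set c := ∫ x, F x ∂(Measure.pi fun _ => nodeLaw f)
  rw [← hX.map_eq_pi, integral_map hX.aemeasurable
    ((hFm.sub_const c).pow_const 2).aestronglyMeasurable]
  refine integral_congr_ae ?_
  filter_upwards [hae] with ω hω
  rw [hω]

theorem IsIIDNodes.integral_tspLength_sub_sq_le {n : ℕ} (hn : 1 ≤ n) {X : Fin n → Ω → Plane}
    (hX : IsIIDNodes P f X) :
    ∫ ω, (tspLength (fun i => X i ω) - ∫ ω', tspLength (fun i => X i ω') ∂P) ^ 2 ∂P ≤ 48 := by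
  match n, hn, X, hX with
  | 1, _, X, _ => simp [tspLength_one]
  | m + 2, _, X, hX => exact hX.integral_tspLength_sub_sq_le_of_two_le

end IID

/-! ### Convergence in probability and the final theorem. -/

theorem tendstoInMeasure_tsp {Ω : Type*} [MeasurableSpace Ω] {P : Measure Ω}
    [IsProbabilityMeasure P] {f : Plane → ℝ} {X : (n : ℕ) → Fin n → Ω → Plane}
    (hX : ∀ n, IsIIDNodes P f (X n)) :
    TendstoInMeasure P
      (fun (n : ℕ) ω => 1 / √(n : ℝ) * (TSP X n ω - ∫ ω', TSP X n ω' ∂P)) atTop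
        (fun _ => (0 : ℝ)) := by
  refine tendstoInMeasure_of_ne_top fun δ hδ hδ' => ?_
  have hδ0 : 0 < δ.toReal := ENNReal.toReal_pos hδ.ne' hδ'
  have hlim : Tendsto (fun n : ℕ => ENNReal.ofReal (48 / (δ.toReal ^ 2 * n))) atTop (nhds 0) := by
    rw [← ENNReal.ofReal_zero]
    refine ENNReal.tendsto_ofReal (Tendsto.div_atTop tendsto_const_nhds ?_)
    exact tendsto_natCast_atTop_atTop.const_mul_atTop (by positivity)
  refine tendsto_of_tendsto_of_tendsto_of_le_of_le' tendsto_const_nhds hlim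
    (Eventually.of_forall fun _ => zero_le) ?_
  filter_upwards [eventually_ge_atTop 1] with n hn
  have hn0 : (0 : ℝ) < n := by exact_mod_cast hn
  have hs : 0 < √(n : ℝ) := Real.sqrt_pos.2 hn0
  have hmem : MemLp (TSP X n) 2 P := (hX n).memLp_tspLength
  have hcheb := meas_ge_le_variance_div_sq hmem (c := δ.toReal * √n) (by positivity)
  have hvar : variance (TSP X n) P ≤ 48 := by
    rw [variance_eq_integral hmem.aemeasurable]
    exact (hX n).integral_tspLength_sub_sq_le hn
  refine (measure_mono fun ω hω => ?_).trans (hcheb.trans (ENNReal.ofReal_le_ofReal ?_))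
  · simp only [Set.mem_ofPred_eq, edist_dist, Real.dist_eq, sub_zero] at hω ⊢
    rw [ENNReal.le_ofReal_iff_toReal_le hδ' (abs_nonneg _), abs_mul, abs_of_pos (by positivity),
      one_div_mul_eq_div, le_div_iff₀ hs] at hω
    exact hω
  · rw [mul_pow, Real.sq_sqrt hn0.le]
    gcongr

theorem theorem2 (ε₁ ε₂ : ℝ) (hε₁ : 0 < ε₁) (hε₁₂ : ε₁ ≤ ε₂) :
    ∃ C θ₁ θ₂ θ₃ : ℝ, 0 < C ∧ 0 < θ₁ ∧ 0 < θ₂ ∧ 0 < θ₃ ∧ ∃ n₀ : ℕ,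
      ∀ (f : Plane → ℝ), IsBoundedDensity f ε₁ ε₂ →
      ∀ (Ω : Type*) [MeasurableSpace Ω] (P : Measure Ω) [IsProbabilityMeasure P]
        -- row `n` of the array consists of the `n` nodes; nothing is assumed between the rows
        (X : (n : ℕ) → Fin n → Ω → Plane), (∀ n, IsIIDNodes P f (X n)) →
        (∀ n : ℕ, 1 ≤ n → MemLp (TSP X n) 2 P ∧
          ∫ ω, (TSP X n ω - ∫ ω', TSP X n ω' ∂P) ^ 2 ∂P ≤ C * (n : ℝ) ^ (2 / 3 : ℝ)) ∧
        TendstoInMeasure P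
          (fun (n : ℕ) ω => 1 / √(n : ℝ) * (TSP X n ω - ∫ ω', TSP X n ω' ∂P)) atTop (fun _ => (0 : ℝ)) ∧
        (∀ n : ℕ, n₀ ≤ n →
          θ₁ * √(n : ℝ) ≤ ∫ ω, TSP X n ω ∂P ∧
          ∫ ω, TSP X n ω ∂P ≤ 5 * √(n : ℝ) ∧
          P.real {ω | TSP X n ω ≤ 5 * √(n : ℝ)} = 1 ∧
          1 - Real.exp (-(θ₃ * n / Real.log n)) ≤ P.real {ω | θ₂ * √(n : ℝ) ≤ TSP X n ω}) := by
  have hε₂ : 0 ≤ ε₂ := (hε₁.trans_le hε₁₂).le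
  obtain ⟨a, ha, haI⟩ : ∃ a : ℝ, 1 ≤ a ∧
      ε₂ * (∫ x : Plane, Real.exp (-‖x‖)) ≤ a * Real.exp (-4) := by
    refine ⟨max 1 (ε₂ * (∫ x : Plane, Real.exp (-‖x‖)) / Real.exp (-4)), le_max_left _ _, ?_⟩
    rw [← div_le_iff₀ (Real.exp_pos _)]
    exact le_max_right _ _
  have ha0 : 0 < a := by linarith
  -- `θ₁` is half of `θ₂`: the tour is at least `θ₂√n` with probability at least 1/2.
  refine ⟨48, 1 / (2 * a), 1 / a, 1, by norm_num, by positivity, by positivity, one_pos, 16000000,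
    fun f hf Ω _ P _ X hX => ⟨fun n hn => ⟨(hX n).memLp_tspLength, ?_⟩, tendstoInMeasure_tsp hX,
      fun n hn => ?_⟩⟩
  · refine ((hX n).integral_tspLength_sub_sq_le hn).trans ?_
    have : (1 : ℝ) ≤ (n : ℝ) ^ (2 / 3 : ℝ) :=
      Real.one_le_rpow (by exact_mod_cast hn) (by norm_num)
    linarith
  have hint : Integrable (TSP X n) P := (hX n).memLp_tspLength.integrable (by norm_num)
  have hup : ∀ᵐ ω ∂P, TSP X n ω ≤ 5 * √(n : ℝ) := by
    filter_upwards [(hX n).ae_mem_unitSquare] with ω hω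
    exact tspLength_le_five_mul_sqrt hn hω
  have hn' : (16000000 : ℝ) ≤ n := by exact_mod_cast hn
  have htail : 1 - Real.exp (-n) ≤ P.real {ω | 1 / a * √(n : ℝ) ≤ TSP X n ω} := by
    have h1 := measureReal_tspLength_lt_le_exp_neg hε₂ hf ha haI (by omega) (hX n)
    have h2 : P.real Set.univ ≤ P.real {ω | 1 / a * √(n : ℝ) ≤ TSP X n ω} +
        P.real {ω | tspLength (fun i => X n i ω) < 1 / a * √(n : ℝ)} := by
      refine (measureReal_mono fun ω _ => ?_).trans (measureReal_union_le _ _)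
      exact le_or_gt (1 / a * √(n : ℝ)) (TSP X n ω)
    rw [probReal_univ] at h2
    linarith
  refine ⟨?_, ?_, ?_, le_trans ?_ htail⟩
  · have hmarkov := mul_meas_ge_le_integral_of_nonneg (μ := P)
      (ae_of_all _ fun ω => tspLength_nonneg fun i => X n i ω) hint (1 / a * √(n : ℝ))
    have hexp : Real.exp (-(n : ℝ)) ≤ 1 / 2 := by
      rw [Real.exp_neg, one_div]
      exact inv_anti₀ two_pos (by linarith [Real.add_one_le_exp (n : ℝ)])
    refine le_trans ?_ hmarkov
    have h3 : 1 / (2 * a) * √(n : ℝ) = 1 / a * √(n : ℝ) * (1 / 2) := by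
      field_simp
    rw [h3]
    gcongr
    exact le_trans (by linarith) htail
  · have := integral_mono_ae hint (integrable_const _) hup
    simpa using this
  · rw [measureReal_congr (eventuallyEq_univ.2 hup), probReal_univ]
  · have hlog : 1 ≤ Real.log n := by
      rw [Real.le_log_iff_exp_le (by linarith)]
      linarith [Real.exp_one_lt_d9]
    have : (1 : ℝ) * n / Real.log n ≤ n := by
      rw [one_mul]
      exact div_le_self (by linarith) hlog
    gcongr
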